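/- Let $E$ be a real Banach lattice with topological dual $E'$, ordered by $f\le g$ iff $f(x)\le g(x)$ for all $x\ge 0$ in $E$. Assume that (a) $E$ is $\sigma$-order complete, that is, every nonempty countable subset of $E$ that is bounded above has a supremum; (b) $E'$ is order continuous, where a Banach lattice is called order continuous if $\|x_\alpha\|\to 0$ for every decreasing net $(x_\alpha)$ in it with infimum $0$; (c) $E$ has the positive Grothendieck property: every sequence of positive functionals in $E'$ that converges to $0$ in the weak$^*$ topology $\sigma(E',E)$ converges to $0$ in the weak topology $\sigma(E',E'')$. Then $E$ is reflexive (the canonical embedding $E\to E''$ is surjective) if and only if $E$ is order continuous. -/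

import Mathlib

open Filter Topology

universe u

namespace BanachLattice

/-- A functional on a vector lattice is determined by its values on the positive cone. -/
theorem dual_ext_of_nonneg {E : Type u} [NormedAddCommGroup E] [NormedSpace ℝ E] [Lattice E]
    [IsOrderedAddMonoid E] {f g : StrongDual ℝ E} (h : ∀ x : E, 0 ≤ x → f x = g x) : f = g := by
  ext x
  rw [← posPart_sub_negPart x, map_sub, map_sub, h _ (posPart_nonneg x), h _ (negPart_nonneg x)]

/-- The canonical order on the topological dual of a Banach lattice: `f ≤ g` if and only if
`f x ≤ g x` for every `x ≥ 0`. -/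
instance dualPartialOrder {E : Type u} [NormedAddCommGroup E] [NormedSpace ℝ E] [Lattice E]
    [IsOrderedAddMonoid E] : PartialOrder (StrongDual ℝ E) where
  le f g := ∀ x : E, 0 ≤ x → f x ≤ g x
  le_refl _ _ _ := le_rfl
  le_trans _ _ _ hfg hgh x hx := (hfg x hx).trans (hgh x hx)
  le_antisymm _ _ hfg hgf := dual_ext_of_nonneg fun x hx => le_antisymm (hfg x hx) (hgf x hx)

/-- `σ`-order completeness: every nonempty countable set that is bounded above has a supremum. -/
def SigmaOrderComplete (E : Type u) [PartialOrder E] : Prop :=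
  ∀ s : Set E, s.Nonempty → s.Countable → BddAbove s → ∃ a : E, IsLUB s a

/-- Order continuity (of the norm): every decreasing net with infimum `0` converges to `0` in
norm. Nets are indexed by directed sets in the universe of the space, which loses nothing, because
the range of a decreasing net is itself a downward directed set in that universe. -/
def OrderContinuous (E : Type u) [NormedAddCommGroup E] [PartialOrder E] : Prop :=
  ∀ (ι : Type u) [Preorder ι] [IsDirectedOrder ι] [Nonempty ι] (x : ι → E),
    Antitone x → IsGLB (Set.range x) 0 → Tendsto (fun i => ‖x i‖) atTop (𝓝 0)

/-- The positive Grothendieck property: every weak-star null sequence of positive functionals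
is weakly null in the dual. -/
def PositiveGrothendieckProperty (E : Type u) [NormedAddCommGroup E] [NormedSpace ℝ E] [Lattice E]
    [IsOrderedAddMonoid E] : Prop :=
  ∀ f : ℕ → StrongDual ℝ E, (∀ n, 0 ≤ f n) →
    Tendsto (fun n => StrongDual.toWeakDual (f n)) atTop (𝓝 0) →
    Tendsto (fun n => toWeakSpace ℝ (StrongDual ℝ E) (f n)) atTop (𝓝 0)

/-- Reflexivity: the canonical embedding into the bidual is onto. -/
def Reflexive (E : Type u) [NormedAddCommGroup E] [NormedSpace ℝ E] : Prop :=
  Function.Surjective (NormedSpace.inclusionInDoubleDual ℝ E)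

end BanachLattice

/-!
A reflexive Banach lattice is order continuous because a decreasing net of positive elements has a
weak cluster point in the bidual; by reflexivity this point is an element of `E`, it is a lower
bound of the net, so it is the infimum `0`, and Mazur's theorem together with monotonicity turns
weak convergence into norm convergence (`orderContinuous_of_reflexive`).

For the converse let `E` and `E'` be order continuous. The dual of a Banach lattice is a Banach
lattice by the Riesz–Kantorovich formula (`dualLattice`), and so is the bidual; it suffices to
represent a positive `φ` in `E''` by an element of `E`.

* The positive Grothendieck property makes `E` a KB-space: norm bounded upward directed sets of
  positive elements have suprema which are norm limits
  (`PositiveGrothendieckProperty.exists_isLUB_mem_closure`). Otherwise there is a norm bounded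
  increasing sequence whose gaps stay away from `0`. The gaps tend to `0` when they are truncated
  at a fixed element, so Hahn–Banach yields positive contractive functionals that see the gaps but
  tend to `0` at a weak unit `w` of the ideal which the gaps generate; their components in the band
  of `w` are weak-star null but not weakly null (`PositiveGrothendieckProperty.not_gaps`).
* Hence, by Zorn's lemma, there is a maximal `x ≥ 0` in `E` with `x ≤ φ`. Then `φ - x` dominates no
  nonzero positive element of `E`.
* Each positive element of `E''` below an element of `E` dominates, if it is not `0`, a nonzero
  positive element of `E` (`exists_pos_inclusion_le`), and an element of `E''` disjoint from `E`
  vanishes (`eq_zero_of_forall_inf_inclusion_eq_zero`). So `φ - x = 0`.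

The last two facts rest on a theorem of Nakano
(`OrderContinuous.exists_null_of_inf_eq_zero`): if `f` and `g` are disjoint positive functionals on
an order continuous Banach lattice, then every positive `x` splits into a part annihilated by `f`
and a part annihilated by `g`. It is a Borel–Cantelli argument
(`OrderContinuous.exists_limsup`), as is the truncation statement above.
-/

namespace BanachLattice

/-! ### Normed lattices -/

section NormedLattice

variable {E : Type u} [NormedAddCommGroup E] [Lattice E]

theorem posPart_smul_of_pos [NormedSpace ℝ E] [IsOrderedModule ℝ E] {c : ℝ} (hc : 0 < c) (x : E) :
    (c • x)⁺ = c • x⁺ := by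
  apply le_antisymm
  · exact sup_le (smul_le_smul_of_nonneg_left (le_posPart x) hc.le)
      (smul_nonneg hc.le (posPart_nonneg x))
  · have h : x ≤ c⁻¹ • (c • x)⁺ := by
      rw [← inv_smul_smul₀ hc.ne' x]
      simpa [smul_smul, hc.ne'] using
        smul_le_smul_of_nonneg_left (le_posPart (c • x)) (inv_nonneg.2 hc.le)
    have h2 : x⁺ ≤ c⁻¹ • (c • x)⁺ :=
      sup_le h (smul_nonneg (inv_nonneg.2 hc.le) (posPart_nonneg _))
    simpa [smul_smul, hc.ne'] using smul_le_smul_of_nonneg_left h2 hc.le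

variable [IsOrderedAddMonoid E]

theorem posPart_add_le (x y : E) : (x + y)⁺ ≤ x⁺ + y⁺ :=
  sup_le (add_le_add (le_posPart x) (le_posPart y))
    (add_nonneg (posPart_nonneg x) (posPart_nonneg y))

variable [HasSolidNorm E]

theorem norm_le_norm_of_nonneg_of_le {x y : E} (hx : 0 ≤ x) (hxy : x ≤ y) : ‖x‖ ≤ ‖y‖ :=
  norm_le_norm_of_abs_le_abs (by rwa [abs_of_nonneg hx, abs_of_nonneg (hx.trans hxy)])

theorem norm_posPart_le (x : E) : ‖x⁺‖ ≤ ‖x‖ :=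
  norm_le_norm_of_abs_le_abs (by
    rw [abs_of_nonneg (posPart_nonneg x)]
    exact sup_le (le_abs_self x) (abs_nonneg x))

theorem norm_negPart_le (x : E) : ‖x⁻‖ ≤ ‖x‖ :=
  norm_le_norm_of_abs_le_abs (by
    rw [abs_of_nonneg (negPart_nonneg x)]
    exact sup_le (neg_le_abs x) (abs_nonneg x))

end NormedLattice

/-! ### Positive functionals -/

theorem dual_nonneg_iff {E : Type u} [NormedAddCommGroup E] [NormedSpace ℝ E] [Lattice E]
    [IsOrderedAddMonoid E] {f : StrongDual ℝ E} : 0 ≤ f ↔ ∀ x : E, 0 ≤ x → 0 ≤ f x :=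
  Iff.rfl

section Functionals

variable {E : Type u} [NormedAddCommGroup E] [NormedSpace ℝ E] [Lattice E] [IsOrderedAddMonoid E]

theorem dual_mono {f : StrongDual ℝ E} (hf : 0 ≤ f) {x y : E} (hxy : x ≤ y) : f x ≤ f y := by
  have := dual_nonneg_iff.1 hf (y - x) (sub_nonneg.2 hxy)
  rw [map_sub] at this
  linarith

instance dualIsOrderedAddMonoid : IsOrderedAddMonoid (StrongDual ℝ E) where
  add_le_add_left f g hfg h x hx := by
    simpa using hfg x hx

variable [HasSolidNorm E]

/-- Homogeneity is automatic: the additive extension of `p` to `E` is continuous, hence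
`ℝ`-linear. -/
theorem exists_dual_eqOn_nonneg_of_additive (p : E → ℝ)
    (hadd : ∀ x y, 0 ≤ x → 0 ≤ y → p (x + y) = p x + p y) (C : ℝ)
    (hC : ∀ x, 0 ≤ x → |p x| ≤ C * ‖x‖) :
    ∃ f : StrongDual ℝ E, ∀ x, 0 ≤ x → f x = p x := by
  have hsub : ∀ a b c d : E, 0 ≤ a → 0 ≤ b → 0 ≤ c → 0 ≤ d → a - b = c - d →
      p a - p b = p c - p d := by
    intro a b c d ha hb hc hd h
    have h1 : a + d = c + b := by rw [sub_eq_sub_iff_add_eq_add] at h; exact h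
    have := hadd a d ha hd
    rw [h1, hadd c b hc hb] at this
    linarith
  have hp0 : p 0 = 0 := by have := hadd 0 0 le_rfl le_rfl; simp at this; exact this
  let F : E →+ ℝ :=
    { toFun := fun x => p x⁺ - p x⁻
      map_zero' := by simp
      map_add' := fun x y => by
        have := hsub (x + y)⁺ (x + y)⁻ (x⁺ + y⁺) (x⁻ + y⁻) (posPart_nonneg _) (negPart_nonneg _)
          (add_nonneg (posPart_nonneg _) (posPart_nonneg _))
          (add_nonneg (negPart_nonneg _) (negPart_nonneg _)) (by
            rw [posPart_sub_negPart, add_sub_add_comm, posPart_sub_negPart, posPart_sub_negPart])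
        rw [this, hadd _ _ (posPart_nonneg _) (posPart_nonneg _),
          hadd _ _ (negPart_nonneg _) (negPart_nonneg _)]
        ring }
  have hF : ∀ x, ‖F x‖ ≤ (2 * |C|) * ‖x‖ := by
    intro x
    have h1 := hC _ (posPart_nonneg x)
    have h2 := hC _ (negPart_nonneg x)
    have h3 : C * ‖x⁺‖ ≤ |C| * ‖x‖ :=
      mul_le_mul (le_abs_self C) (norm_posPart_le x) (norm_nonneg _) (abs_nonneg _)
    have h4 : C * ‖x⁻‖ ≤ |C| * ‖x‖ :=
      mul_le_mul (le_abs_self C) (norm_negPart_le x) (norm_nonneg _) (abs_nonneg _)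
    have h5 : |p x⁺ - p x⁻| ≤ |p x⁺| + |p x⁻| := abs_sub _ _
    change |p x⁺ - p x⁻| ≤ _
    linarith
  refine ⟨F.toRealLinearMap (AddMonoidHomClass.continuous_of_bound F _ hF), fun x hx => ?_⟩
  change p x⁺ - p x⁻ = p x
  rw [posPart_of_nonneg hx, negPart_of_nonneg hx, hp0, sub_zero]

variable [IsOrderedModule ℝ E]

/-- The Hahn–Banach theorem for the sublinear functional `x ↦ ‖x⁺‖`: any functional dominated by
it is positive and contractive. -/
theorem exists_dual_nonneg_apply_eq_norm_posPart (x : E) :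
    ∃ f : StrongDual ℝ E, 0 ≤ f ∧ (∀ y, f y ≤ ‖y⁺‖) ∧ f x = ‖x⁺‖ := by
  rcases eq_or_ne x 0 with rfl | hx
  · exact ⟨0, le_rfl, fun y => by simp, by simp⟩
  let N : E → ℝ := fun y => ‖y⁺‖
  have hN : ∀ c : ℝ, 0 < c → ∀ y, N (c • y) = c * N y := by
    intro c hc y
    simp only [N]
    rw [posPart_smul_of_pos hc, norm_smul, Real.norm_of_nonneg hc.le]
  have hNadd : ∀ y z, N (y + z) ≤ N y + N z := fun y z =>
    (norm_le_norm_of_nonneg_of_le (posPart_nonneg _) (posPart_add_le y z)).trans (norm_add_le _ _)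
  let f0 : E →ₗ.[ℝ] ℝ := LinearPMap.mkSpanSingleton x (N x) hx
  obtain ⟨g, hg, hgN⟩ := exists_extension_of_le_sublinear f0 N hN hNadd (by
    rintro ⟨y, hy⟩
    obtain ⟨c, rfl⟩ := Submodule.mem_span_singleton.1 hy
    have : f0 ⟨c • x, hy⟩ = c * N x := LinearPMap.mkSpanSingleton'_apply x (N x) _ c hy
    rw [this]
    rcases lt_or_ge 0 c with hc | hc
    · exact (hN c hc x).ge
    · exact (mul_nonpos_of_nonpos_of_nonneg hc (norm_nonneg _)).trans (norm_nonneg _))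
  have hle : ∀ y, g y ≤ ‖y‖ := fun y => (hgN y).trans (norm_posPart_le y)
  have hgx : g x = N x := by
    have h := hg ⟨x, Submodule.mem_span_singleton_self x⟩
    have h' : f0 ⟨x, Submodule.mem_span_singleton_self x⟩ = N x :=
      LinearPMap.mkSpanSingleton'_apply_self _ _ _ _
    rw [← h', ← h]
  refine ⟨g.mkContinuous 1 fun y => ?_, dual_nonneg_iff.2 fun y hy => ?_, hgN, hgx⟩
  · rw [one_mul, Real.norm_eq_abs, abs_le]
    have := hle (-y)
    rw [map_neg, norm_neg] at this
    exact ⟨by linarith, hle y⟩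
  · have := hgN (-y)
    have h0 : (-y)⁺ = 0 := by rw [posPart_eq_zero]; simpa using hy
    simp only [N, h0, norm_zero, map_neg] at this
    change 0 ≤ g y
    linarith

theorem nonpos_of_forall_dual_nonneg {x : E} (h : ∀ f : StrongDual ℝ E, 0 ≤ f → f x ≤ 0) :
    x ≤ 0 := by
  obtain ⟨f, hf, -, hfx⟩ := exists_dual_nonneg_apply_eq_norm_posPart x
  have h0 : ‖x⁺‖ ≤ 0 := hfx ▸ h f hf
  exact posPart_eq_zero.1 (norm_le_zero_iff.1 h0)

end Functionals

/-! ### The lattice structure of the dual -/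

section DualLattice

variable {E : Type u} [NormedAddCommGroup E] [NormedSpace ℝ E] [Lattice E] [IsOrderedAddMonoid E]
  [HasSolidNorm E]

theorem abs_dual_apply_le (f : StrongDual ℝ E) {x y : E} (hy : 0 ≤ y) (hyx : y ≤ x) :
    |f y| ≤ ‖f‖ * ‖x‖ :=
  (f.le_opNorm y).trans
    (mul_le_mul_of_nonneg_left (norm_le_norm_of_nonneg_of_le hy hyx) (norm_nonneg f))

/-- The Riesz–Kantorovich formula. -/
theorem exists_dual_isLUB (f g : StrongDual ℝ E) :
    ∃ h : StrongDual ℝ E, ∀ x : E, 0 ≤ x →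
      IsLUB ((fun y => f y + g (x - y)) '' Set.Icc 0 x) (h x) := by
  have hbound : ∀ x y : E, y ∈ Set.Icc 0 x → |f y + g (x - y)| ≤ (‖f‖ + ‖g‖) * ‖x‖ := by
    intro x y hy
    have h1 := abs_dual_apply_le f hy.1 hy.2
    have h2 := abs_dual_apply_le g (sub_nonneg.2 hy.2) (sub_le_self x hy.1)
    have := abs_add_le (f y) (g (x - y))
    linarith
  have hlub : ∀ x : E, 0 ≤ x → IsLUB ((fun y => f y + g (x - y)) '' Set.Icc 0 x)
      (sSup ((fun y => f y + g (x - y)) '' Set.Icc 0 x)) := by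
    intro x hx
    refine isLUB_csSup ⟨_, 0, ⟨le_rfl, hx⟩, rfl⟩ ⟨(‖f‖ + ‖g‖) * ‖x‖, ?_⟩
    rintro _ ⟨y, hy, rfl⟩
    exact (abs_le.1 (hbound x y hy)).2
  have hadd : ∀ a b : E, 0 ≤ a → 0 ≤ b →
      sSup ((fun y => f y + g (a + b - y)) '' Set.Icc 0 (a + b)) =
        sSup ((fun y => f y + g (a - y)) '' Set.Icc 0 a) +
          sSup ((fun y => f y + g (b - y)) '' Set.Icc 0 b) := by
    intro a b ha hb
    apply le_antisymm
    · refine (hlub _ (add_nonneg ha hb)).2 ?_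
      rintro _ ⟨y, hy, rfl⟩
      -- The Riesz decomposition `y = y ⊓ a + (y - y ⊓ a)`.
      have hc : y - y ⊓ a ≤ b := by
        rw [sub_le_iff_le_add, add_inf]
        exact le_inf (le_add_of_nonneg_left hb) (by rw [add_comm]; exact hy.2)
      have h1 := (hlub a ha).1 ⟨y ⊓ a, ⟨le_inf hy.1 ha, inf_le_right⟩, rfl⟩
      have h2 := (hlub b hb).1 ⟨y - y ⊓ a, ⟨sub_nonneg.2 inf_le_left, hc⟩, rfl⟩
      simp only [map_sub, map_add] at h1 h2 ⊢
      linarith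
    · rw [← le_sub_iff_add_le]
      refine (hlub a ha).2 ?_
      rintro _ ⟨y, hy, rfl⟩
      rw [le_sub_comm]
      refine (hlub b hb).2 ?_
      rintro _ ⟨z, hz, rfl⟩
      rw [le_sub_iff_add_le]
      have h1 := (hlub (a + b) (add_nonneg ha hb)).1
        ⟨y + z, ⟨add_nonneg hy.1 hz.1, add_le_add hy.2 hz.2⟩, rfl⟩
      refine le_trans (le_of_eq ?_) h1
      simp only [map_sub, map_add]
      ring
  have habs : ∀ x : E, 0 ≤ x →
      |sSup ((fun y => f y + g (x - y)) '' Set.Icc 0 x)| ≤ (‖f‖ + ‖g‖) * ‖x‖ := by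
    intro x hx
    have h0 : (0 : E) ∈ Set.Icc 0 x := ⟨le_rfl, hx⟩
    refine abs_le.2 ⟨?_, (hlub x hx).2 ?_⟩
    · exact (abs_le.1 (hbound x 0 h0)).1.trans ((hlub x hx).1 ⟨0, h0, rfl⟩)
    · rintro _ ⟨y, hy, rfl⟩
      exact (abs_le.1 (hbound x y hy)).2
  obtain ⟨h, hh⟩ := exists_dual_eqOn_nonneg_of_additive _ hadd _ habs
  exact ⟨h, fun x hx => by rw [hh x hx]; exact hlub x hx⟩

/-- The supremum of two functionals, given on the positive cone by the Riesz–Kantorovich formula. -/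
noncomputable def dualSup (f g : StrongDual ℝ E) : StrongDual ℝ E :=
  (exists_dual_isLUB f g).choose

theorem isLUB_dualSup_apply (f g : StrongDual ℝ E) {x : E} (hx : 0 ≤ x) :
    IsLUB ((fun y => f y + g (x - y)) '' Set.Icc 0 x) (dualSup f g x) :=
  (exists_dual_isLUB f g).choose_spec x hx

theorem le_dualSup_left (f g : StrongDual ℝ E) : f ≤ dualSup f g := fun x hx =>
  (isLUB_dualSup_apply f g hx).1 ⟨x, ⟨hx, le_rfl⟩, by simp⟩

theorem le_dualSup_right (f g : StrongDual ℝ E) : g ≤ dualSup f g := fun x hx =>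
  (isLUB_dualSup_apply f g hx).1 ⟨0, ⟨le_rfl, hx⟩, by simp⟩

theorem dualSup_le {f g h : StrongDual ℝ E} (hf : f ≤ h) (hg : g ≤ h) : dualSup f g ≤ h := by
  intro x hx
  refine (isLUB_dualSup_apply f g hx).2 ?_
  rintro _ ⟨y, hy, rfl⟩
  have h1 := hf y hy.1
  have h2 := hg (x - y) (sub_nonneg.2 hy.2)
  simp only [map_sub] at h2 ⊢
  linarith

/-- The lattice structure of the dual of a normed lattice. It is not a global instance, so that
elsewhere the order on the dual is syntactically `BanachLattice.dualPartialOrder`. -/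
@[reducible] noncomputable def dualLattice : Lattice (StrongDual ℝ E) :=
  { dualPartialOrder with
    sup := dualSup
    le_sup_left := le_dualSup_left
    le_sup_right := le_dualSup_right
    sup_le := fun _ _ _ => dualSup_le
    inf := fun f g => -dualSup (-f) (-g)
    inf_le_left := fun f g => neg_le.1 (le_dualSup_left (-f) (-g))
    inf_le_right := fun f g => neg_le.1 (le_dualSup_right (-f) (-g))
    le_inf := fun _ _ _ hf hg => le_neg.1 (dualSup_le (neg_le_neg hf) (neg_le_neg hg)) }

attribute [local instance] dualLattice

theorem isGLB_dual_inf_apply (f g : StrongDual ℝ E) {x : E} (hx : 0 ≤ x) :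
    IsGLB ((fun y => f y + g (x - y)) '' Set.Icc 0 x) ((f ⊓ g) x) := by
  have h := isLUB_dualSup_apply (-f) (-g) hx
  change IsGLB _ (-(dualSup (-f) (-g)) x)
  constructor
  · rintro _ ⟨y, hy, rfl⟩
    have := h.1 ⟨y, hy, rfl⟩
    simp only [neg_apply] at this ⊢
    linarith
  · intro c hc
    have : dualSup (-f) (-g) x ≤ -c := by
      refine h.2 ?_
      rintro _ ⟨y, hy, rfl⟩
      have := hc ⟨y, hy, rfl⟩
      simp only [neg_apply] at this ⊢
      linarith
    linarith

instance dualHasSolidNorm : HasSolidNorm (StrongDual ℝ E) where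
  solid f g hfg := by
    refine f.opNorm_le_bound (norm_nonneg g) fun x => ?_
    have h1 : |f x| ≤ |f| |x| := by
      have hp := posPart_nonneg x
      have hn := negPart_nonneg x
      have a1 := le_abs_self f x⁺ hp
      have a2 := le_abs_self f x⁻ hn
      have a3 := neg_le_abs f x⁺ hp
      have a4 := neg_le_abs f x⁻ hn
      simp only [neg_apply] at a3 a4
      have e1 : f x = f x⁺ - f x⁻ := by rw [← map_sub, posPart_sub_negPart]
      rw [← posPart_add_negPart x, map_add, e1, abs_le]
      constructor <;> linarith
    have h2 : |f| |x| ≤ |g| |x| := hfg |x| (abs_nonneg x)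
    have h3 : |g| |x| ≤ ‖g‖ * ‖x‖ := by
      refine (isLUB_dualSup_apply g (-g) (abs_nonneg x)).2 ?_
      rintro _ ⟨y, hy, rfl⟩
      have e : g y + (-g) (|x| - y) = g (y + y - |x|) := by
        simp only [neg_apply, map_sub, map_add]; ring
      change g y + (-g) (|x| - y) ≤ _
      rw [e]
      refine (le_abs_self _).trans ((g.le_opNorm _).trans (mul_le_mul_of_nonneg_left
        ((norm_le_norm_of_abs_le_abs (abs_le'.2
          ⟨?_, ?_⟩)).trans_eq (norm_abs_eq_norm x)) (norm_nonneg g)))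
      · rw [abs_abs, sub_le_iff_le_add]
        exact add_le_add hy.2 hy.2
      · rw [abs_abs, neg_sub, sub_le_self_iff]
        exact add_nonneg hy.1 hy.1
    exact h1.trans (h2.trans h3)

end DualLattice

/-! ### Consequences of order continuity -/

section OrderContinuity

theorem OrderContinuous.exists_norm_lt {X : Type u} [NormedAddCommGroup X] [PartialOrder X]
    (hX : OrderContinuous X) {D : Set X} (hne : D.Nonempty) (hdir : DirectedOn (· ≥ ·) D)
    (hD : IsGLB D 0) {ε : ℝ} (hε : 0 < ε) : ∃ d ∈ D, ‖d‖ < ε := by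
  have : Nonempty (↥D)ᵒᵈ := ⟨OrderDual.toDual ⟨hne.some, hne.some_mem⟩⟩
  have : IsDirectedOrder (↥D)ᵒᵈ := ⟨fun a b => by
    obtain ⟨c, hc, hca, hcb⟩ := hdir a.ofDual a.ofDual.2 b.ofDual b.ofDual.2
    exact ⟨OrderDual.toDual ⟨c, hc⟩, hca, hcb⟩⟩
  have hr : Set.range (fun i : (↥D)ᵒᵈ => (i.ofDual : X)) = D := by
    ext y
    exact ⟨fun ⟨i, hi⟩ => hi ▸ i.ofDual.2, fun hy => ⟨OrderDual.toDual ⟨y, hy⟩, rfl⟩⟩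
  have h := hX (↥D)ᵒᵈ (fun i => (i.ofDual : X)) (fun a b hab => hab) (by rwa [hr])
  obtain ⟨i, hi⟩ := (h.eventually (gt_mem_nhds hε)).exists
  exact ⟨i.ofDual, i.ofDual.2, hi⟩

/-- An upward directed set which is Cauchy as a net has a supremum, which is also its limit. -/
theorem exists_isLUB_mem_closure {X : Type u} [NormedAddCommGroup X] [Lattice X]
    [IsOrderedAddMonoid X] [HasSolidNorm X] [CompleteSpace X] {D : Set X}
    (hdir : DirectedOn (· ≤ ·) D)
    (hD : ∀ ε : ℝ, 0 < ε → ∃ d ∈ D, ∀ d' ∈ D, d ≤ d' → ‖d' - d‖ ≤ ε) :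
    ∃ l, IsLUB D l ∧ l ∈ closure D := by
  have hpos : ∀ n : ℕ, (0 : ℝ) < 1 / ((n : ℝ) + 1) := fun n => Nat.one_div_pos_of_nat
  choose d hdD hd using fun n : ℕ => hD _ (hpos n)
  have hanti : ∀ {n N : ℕ}, N ≤ n → 1 / ((n : ℝ) + 1) ≤ 1 / ((N : ℝ) + 1) := fun h =>
    Nat.one_div_le_one_div h
  have hb : Tendsto (fun n : ℕ => 1 / ((n : ℝ) + 1)) atTop (𝓝 0) :=
    tendsto_one_div_add_atTop_nhds_zero_nat
  have hcau : CauchySeq d := by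
    refine cauchySeq_of_le_tendsto_0 (fun N : ℕ => 2 * (1 / ((N : ℝ) + 1))) (fun n m N hn hm => ?_)
      (by simpa using hb.const_mul 2)
    obtain ⟨c, hc, hnc, hmc⟩ := hdir _ (hdD n) _ (hdD m)
    have h1 := (hd n c hc hnc).trans (hanti hn)
    have h2 := (hd m c hc hmc).trans (hanti hm)
    have h3 : d n - d m = (c - d m) - (c - d n) := by abel
    rw [dist_eq_norm, h3]
    linarith [norm_sub_le (c - d m) (c - d n)]
  obtain ⟨l, hl⟩ := cauchySeq_tendsto_of_complete hcau
  refine ⟨l, ⟨fun c hc => ?_, fun u hu => le_of_tendsto' hl fun n => hu (hdD n)⟩,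
    mem_closure_of_tendsto hl (Eventually.of_forall hdD)⟩
  choose c' hc' hcc' hdc' using fun n => hdir c hc _ (hdD n)
  have h0 : Tendsto (fun n => c' n - d n) atTop (𝓝 0) :=
    squeeze_zero_norm (fun n => hd n _ (hc' n) (hdc' n)) hb
  have hlim : Tendsto c' atTop (𝓝 l) := by simpa using h0.add hl
  exact ge_of_tendsto' hlim hcc'

variable {X : Type u} [NormedAddCommGroup X] [NormedSpace ℝ X] [Lattice X] [IsOrderedAddMonoid X]
  [HasSolidNorm X] [CompleteSpace X]

/-- Order continuity makes the space Dedekind complete, with suprema attained as norm limits. -/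
theorem OrderContinuous.exists_isLUB_mem_closure (hX : OrderContinuous X) {D : Set X}
    (hne : D.Nonempty) (hdir : DirectedOn (· ≤ ·) D) (hbdd : BddAbove D) :
    ∃ l, IsLUB D l ∧ l ∈ closure D := by
  refine BanachLattice.exists_isLUB_mem_closure hdir fun ε hε => ?_
  -- The gaps between upper bounds and elements of `D` decrease to `0`.
  let G : Set X := {z | ∃ v ∈ upperBounds D, ∃ d ∈ D, z = v - d}
  have hG0 : ∀ z ∈ G, 0 ≤ z := by
    rintro _ ⟨v, hv, d, hd, rfl⟩
    exact sub_nonneg.2 (hv hd)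
  have hGdir : DirectedOn (· ≥ ·) G := by
    rintro _ ⟨v, hv, d, hd, rfl⟩ _ ⟨v', hv', d', hd', rfl⟩
    obtain ⟨c, hc, hdc, hdc'⟩ := hdir d hd d' hd'
    exact ⟨v ⊓ v' - c, ⟨v ⊓ v', fun e he => le_inf (hv he) (hv' he), c, hc, rfl⟩,
      sub_le_sub inf_le_left hdc, sub_le_sub inf_le_right hdc'⟩
  obtain ⟨v, hv⟩ := hbdd
  obtain ⟨d, hd⟩ := hne
  have hGlb : IsGLB G 0 := by
    refine ⟨hG0, fun w hw => ?_⟩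
    have hw' : ∀ z ∈ G, w⁺ ≤ z := fun z hz => sup_le (hw hz) (hG0 z hz)
    have hn : ∀ n : ℕ, v - n • w⁺ ∈ upperBounds D := by
      intro n
      induction n with
      | zero => simpa using hv
      | succ n ih =>
        intro e he
        have := hw' _ ⟨_, ih, e, he, rfl⟩
        rw [succ_nsmul, ← sub_sub, le_sub_comm]
        exact this
    have hle : ∀ n : ℕ, n • w⁺ ≤ v - d := fun n => le_sub_comm.1 (hn n hd)
    -- The archimedean property, read off from the norm.
    have hnorm : ‖w⁺‖ ≤ 0 := by
      by_contra hlt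
      obtain ⟨n, hn⟩ := exists_lt_nsmul (not_le.1 hlt) ‖v - d‖
      have := norm_le_norm_of_nonneg_of_le (nsmul_nonneg (posPart_nonneg w) n) (hle n)
      rw [← Nat.cast_smul_eq_nsmul ℝ, norm_smul, Real.norm_natCast] at this
      rw [nsmul_eq_mul] at hn
      linarith
    exact posPart_eq_zero.1 (norm_le_zero_iff.1 hnorm)
  obtain ⟨_, ⟨v, hv, d, hd, rfl⟩, hlt⟩ := hX.exists_norm_lt (D := G)
    ⟨v - d, v, hv, d, hd, rfl⟩ hGdir hGlb hε
  exact ⟨d, hd, fun d' hd' hdd' => (norm_le_norm_of_nonneg_of_le (sub_nonneg.2 hdd')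
    (sub_le_sub_right (hv hd') d)).trans hlt.le⟩

theorem OrderContinuous.exists_tendsto_of_monotone (hX : OrderContinuous X) {s : ℕ → X}
    (hs : Monotone s) (hbdd : BddAbove (Set.range s)) : ∃ l, Tendsto s atTop (𝓝 l) := by
  obtain ⟨l, hl, hcl⟩ := hX.exists_isLUB_mem_closure (Set.range_nonempty s)
    (directedOn_range.2 hs.directed_le) hbdd
  refine ⟨l, Metric.tendsto_atTop.2 fun ε hε => ?_⟩
  obtain ⟨_, ⟨k, rfl⟩, hk⟩ := Metric.mem_closure_iff.1 hcl ε hε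
  refine ⟨k, fun n hn => lt_of_le_of_lt ?_ hk⟩
  rw [dist_comm, dist_eq_norm, dist_eq_norm]
  exact norm_le_norm_of_nonneg_of_le (sub_nonneg.2 (hl.1 ⟨n, rfl⟩)) (sub_le_sub_left (hs hn) l)

theorem OrderContinuous.exists_tendsto_of_antitone (hX : OrderContinuous X) {s : ℕ → X}
    (hs : Antitone s) {b : X} (hbdd : ∀ n, b ≤ s n) : ∃ l, Tendsto s atTop (𝓝 l) := by
  obtain ⟨l, hl⟩ := hX.exists_tendsto_of_monotone (s := fun n => -s n)
    (fun m n hmn => neg_le_neg (hs hmn)) ⟨-b, by rintro _ ⟨n, rfl⟩; exact neg_le_neg (hbdd n)⟩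
  exact ⟨-l, by simpa using hl.neg⟩

/-- A Borel–Cantelli lemma: `l` is the upper limit of the sequence `u`, and a positive functional
vanishes on it as soon as its values along `u` are summable. -/
theorem OrderContinuous.exists_limsup (hX : OrderContinuous X) {x : X} {u : ℕ → X}
    (hu : ∀ n, u n ∈ Set.Icc 0 x) :
    ∃ (h : ℕ → X) (l : X), (∀ n, u n ≤ h n ∧ h n ≤ x) ∧ Tendsto h atTop (𝓝 l) ∧ 0 ≤ l ∧
      ∀ f : StrongDual ℝ X, 0 ≤ f → Summable (fun n => f (u n)) → f l = 0 := by
  let v : ℕ → ℕ → X := fun n => partialSups fun k => u (n + k)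
  have hvx : ∀ n m, v n m ≤ x := fun n m => partialSups_le _ _ _ fun k _ => (hu _).2
  choose h hh using fun n => hX.exists_tendsto_of_monotone (s := v n)
    (partialSups fun k => u (n + k)).monotone ⟨x, by rintro _ ⟨m, rfl⟩; exact hvx n m⟩
  have hvh : ∀ n m, v n m ≤ h n := fun n m =>
    (partialSups fun k => u (n + k)).monotone.ge_of_tendsto (hh n) m
  have huh : ∀ n, u n ≤ h n := fun n => by simpa [v] using hvh n 0
  have hanti : Antitone h := antitone_nat_of_succ_le fun n =>
      le_of_tendsto' (hh (n + 1)) fun m => by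
    refine le_trans (partialSups_le _ _ _ fun k hk => ?_) (hvh n (m + 1))
    have := le_partialSups_of_le (fun k => u (n + k)) (Nat.succ_le_succ hk)
    simpa [v, Nat.succ_eq_add_one, add_assoc, add_comm, add_left_comm] using this
  have h0 : ∀ n, 0 ≤ h n := fun n => (hu n).1.trans (huh n)
  obtain ⟨l, hl⟩ := hX.exists_tendsto_of_antitone hanti h0
  refine ⟨h, l, fun n => ⟨huh n, le_of_tendsto' (hh n) (hvx n)⟩, hl, ge_of_tendsto' hl h0,
    fun f hf hsum => le_antisymm ?_ (dual_nonneg_iff.1 hf l (ge_of_tendsto' hl h0))⟩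
  have hfu : ∀ n, 0 ≤ f (u n) := fun n => dual_nonneg_iff.1 hf _ (hu n).1
  have htail : ∀ n, f (h n) ≤ ∑' k, f (u (k + n)) := by
    intro n
    have hs : Summable fun k => f (u (k + n)) := (summable_nat_add_iff n).2 hsum
    refine le_of_tendsto' ((f.continuous.tendsto _).comp (hh n)) fun m => ?_
    have hv : v n m ≤ ∑ k ∈ Finset.range (m + 1), u (k + n) := by
      refine partialSups_le _ _ _ fun k hk => ?_
      rw [add_comm n k]
      exact Finset.single_le_sum (f := fun k => u (k + n)) (fun i _ => (hu _).1)
        (Finset.mem_range.2 (Nat.lt_succ_of_le hk))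
    have hfv := dual_mono hf hv
    rw [map_sum] at hfv
    exact hfv.trans (hs.sum_le_tsum _ fun i _ => hfu _)
  exact le_of_tendsto_of_tendsto' ((f.continuous.tendsto _).comp hl)
    (tendsto_sum_nat_add fun n => f (u n)) htail

theorem OrderContinuous.exists_greatest_null (hX : OrderContinuous X) {f : StrongDual ℝ X}
    (hf : 0 ≤ f) {x : X} (hx : 0 ≤ x) :
    ∃ u₀, IsGreatest {u | u ∈ Set.Icc 0 x ∧ f u = 0} u₀ := by
  have hclosed : IsClosed {u | u ∈ Set.Icc 0 x ∧ f u = 0} :=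
    isClosed_Icc.inter (isClosed_singleton.preimage f.continuous)
  have hdir : DirectedOn (· ≤ ·) {u | u ∈ Set.Icc 0 x ∧ f u = 0} := fun a ha b hb => by
    have hab : a ⊔ b ≤ a + b :=
      sup_le (le_add_of_nonneg_right hb.1.1) (le_add_of_nonneg_left ha.1.1)
    have h0 : 0 ≤ a ⊔ b := ha.1.1.trans le_sup_left
    have hfab := dual_mono hf hab
    rw [map_add, ha.2, hb.2, add_zero] at hfab
    exact ⟨a ⊔ b, ⟨⟨h0, sup_le ha.1.2 hb.1.2⟩, le_antisymm hfab (dual_nonneg_iff.1 hf _ h0)⟩,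
      le_sup_left, le_sup_right⟩
  have hne : {u | u ∈ Set.Icc 0 x ∧ f u = 0}.Nonempty := ⟨0, ⟨le_rfl, hx⟩, map_zero f⟩
  obtain ⟨l, hl, hcl⟩ := hX.exists_isLUB_mem_closure hne hdir ⟨x, fun u hu => hu.1.2⟩
  exact ⟨l, hclosed.closure_eq ▸ hcl, hl.1⟩

attribute [local instance] dualLattice in
/-- Nakano's theorem: disjoint positive functionals on an order continuous Banach lattice live on
complementary parts of each positive element. -/
theorem OrderContinuous.exists_null_of_inf_eq_zero (hX : OrderContinuous X)
    {f g : StrongDual ℝ X} (hf : 0 ≤ f) (hg : 0 ≤ g) (hfg : f ⊓ g = 0) {x : X} (hx : 0 ≤ x) :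
    ∃ u ∈ Set.Icc 0 x, f u = 0 ∧ g (x - u) = 0 := by
  have hglb := isGLB_dual_inf_apply f g hx
  rw [hfg, zero_apply] at hglb
  have hex : ∀ n : ℕ, ∃ u ∈ Set.Icc 0 x, f u + g (x - u) < (1 / 2 : ℝ) ^ n := fun n => by
    obtain ⟨_, ⟨u, hu, rfl⟩, -, hlt⟩ := hglb.exists_between
      (show (0 : ℝ) < (1 / 2) ^ n by positivity)
    exact ⟨u, hu, hlt⟩
  choose u hu hlt using hex
  have hgeom : Summable fun n : ℕ => (1 / 2 : ℝ) ^ n := summable_geometric_two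
  obtain ⟨h, l, hh, hl, hl0, hnull⟩ := hX.exists_limsup hu
  have hfu : ∀ n, 0 ≤ f (u n) := fun n => dual_nonneg_iff.1 hf _ (hu n).1
  have hgu : ∀ n, 0 ≤ g (x - u n) := fun n => dual_nonneg_iff.1 hg _ (sub_nonneg.2 (hu n).2)
  have hlx : l ≤ x := le_of_tendsto' hl fun n => (hh n).2
  refine ⟨l, ⟨hl0, hlx⟩, hnull f hf (Summable.of_nonneg_of_le hfu
    (fun n => by linarith [hlt n, hgu n]) hgeom), le_antisymm ?_
    (dual_nonneg_iff.1 hg _ (sub_nonneg.2 hlx))⟩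
  have h1 : Tendsto (fun n => g (x - h n)) atTop (𝓝 (g (x - l))) :=
    (g.continuous.tendsto _).comp (tendsto_const_nhds.sub hl)
  refine le_of_tendsto_of_tendsto' h1 hgeom.tendsto_atTop_zero fun n => ?_
  have := dual_mono hg (sub_le_sub_left (hh n).1 x)
  linarith [hlt n, hfu n]

end OrderContinuity

/-! ### Weak limits in the bidual -/

/-- Weak-star compactness of the balls of the bidual, in terms of ultrafilters. -/
theorem exists_bidual_tendsto {E ι : Type*} [NormedAddCommGroup E] [NormedSpace ℝ E] {x : ι → E}
    {M : ℝ} {U : Ultrafilter ι} (hx : ∀ᶠ i in U, ‖x i‖ ≤ M) :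
    ∃ φ : StrongDual ℝ (StrongDual ℝ E), ∀ f, Tendsto (fun i => f (x i)) U (𝓝 (φ f)) := by
  let J : ι → WeakDual ℝ (StrongDual ℝ E) := fun i =>
    StrongDual.toWeakDual (NormedSpace.inclusionInDoubleDual ℝ E (x i))
  have hmem : ∀ᶠ i in U, J i ∈ WeakDual.toStrongDual ⁻¹' Metric.closedBall
      (0 : StrongDual ℝ (StrongDual ℝ E)) M := hx.mono fun i hi =>
    (mem_closedBall_zero_iff (E := StrongDual ℝ (StrongDual ℝ E))).2
      ((NormedSpace.double_dual_bound ℝ E (x i)).trans hi)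
  obtain ⟨φ, -, hφ⟩ := (WeakDual.isCompact_closedBall (𝕜 := ℝ)
    (0 : StrongDual ℝ (StrongDual ℝ E)) M).ultrafilter_le_nhds (U.map J) (le_principal_iff.2 hmem)
  exact ⟨WeakDual.toStrongDual φ, fun f =>
    ((WeakDual.eval_continuous f).tendsto φ).comp hφ⟩

section Reflexive

variable {E : Type u} [NormedAddCommGroup E] [NormedSpace ℝ E] [Lattice E] [IsOrderedAddMonoid E]
  [IsOrderedModule ℝ E] [HasSolidNorm E]

theorem orderContinuous_of_reflexive (hE : Reflexive E) : OrderContinuous E := by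
  intro ι _ _ _ x hx hglb
  have hx0 : ∀ i, 0 ≤ x i := fun i => hglb.1 ⟨i, rfl⟩
  obtain ⟨i₀⟩ := ‹Nonempty ι›
  let U : Ultrafilter ι := Ultrafilter.of atTop
  have hUle : (U : Filter ι) ≤ atTop := Ultrafilter.of_le _
  obtain ⟨φ, hφ⟩ := exists_bidual_tendsto (x := x) (M := ‖x i₀‖) (U := U)
    (hUle ((eventually_ge_atTop i₀).mono fun i hi =>
      norm_le_norm_of_nonneg_of_le (hx0 _) (hx hi)))
  obtain ⟨y, rfl⟩ := hE φ
  have hφ' : ∀ f : StrongDual ℝ E, Tendsto (fun i => f (x i)) U (𝓝 (f y)) := hφ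
  -- The weak limit `y` is a positive lower bound of the net, hence `0`.
  have hy0 : 0 ≤ y := by
    rw [← neg_nonpos]
    refine nonpos_of_forall_dual_nonneg fun f hf => ?_
    rw [map_neg, neg_nonpos]
    exact ge_of_tendsto' (hφ' f) fun i => dual_nonneg_iff.1 hf _ (hx0 i)
  have hylb : y ∈ lowerBounds (Set.range x) := by
    rintro _ ⟨j, rfl⟩
    rw [← sub_nonpos]
    refine nonpos_of_forall_dual_nonneg fun f hf => ?_
    rw [map_sub, sub_nonpos]
    refine le_of_tendsto (hφ' f) (hUle ?_)
    filter_upwards [eventually_ge_atTop j] with i hi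
    exact dual_mono hf (hx hi)
  obtain rfl : y = 0 := le_antisymm (hglb.2 hylb) hy0
  -- By Mazur's theorem, `0` is a norm limit of convex combinations of the net.
  have hmazur : (0 : E) ∈ closure (convexHull ℝ (Set.range x)) := by
    by_contra h0
    obtain ⟨f, c, hc0, hc⟩ := geometric_hahn_banach_point_closed
      (convex_convexHull ℝ (Set.range x)).closure isClosed_closure h0
    have hle := ge_of_tendsto' (hφ' f) fun i =>
      (hc _ (subset_closure (subset_convexHull ℝ _ ⟨i, rfl⟩))).le
    rw [map_zero] at hc0 hle
    linarith
  have hdom : convexHull ℝ (Set.range x) ⊆ {c | ∃ i, x i ≤ c} := by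
    refine convexHull_min (by rintro _ ⟨i, rfl⟩; exact ⟨i, le_rfl⟩) ?_
    rintro c ⟨i, hi⟩ d ⟨j, hj⟩ a b ha hb hab
    obtain ⟨k, hik, hjk⟩ := exists_ge_ge i j
    refine ⟨k, ?_⟩
    calc x k = a • x k + b • x k := by rw [← add_smul, hab, one_smul]
      _ ≤ a • c + b • d := add_le_add
        (smul_le_smul_of_nonneg_left ((hx hik).trans hi) ha)
        (smul_le_smul_of_nonneg_left ((hx hjk).trans hj) hb)
  refine tendsto_order.2 ⟨fun r hr => Eventually.of_forall fun i => hr.trans_le (norm_nonneg _),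
    fun ε hε => ?_⟩
  obtain ⟨c, hc, hcε⟩ := Metric.mem_closure_iff.1 hmazur ε hε
  obtain ⟨i, hi⟩ := hdom hc
  filter_upwards [eventually_ge_atTop i] with j hj
  rw [dist_zero_left] at hcε
  exact (norm_le_norm_of_nonneg_of_le (hx0 j) ((hx hj).trans hi)).trans_lt hcε

end Reflexive

/-! ### Increasing sequences and the positive Grothendieck property -/

theorem tendsto_toWeakDual_zero_of_nonneg {E : Type u} [NormedAddCommGroup E]
    [NormedSpace ℝ E] [Lattice E] [IsOrderedAddMonoid E] {g : ℕ → StrongDual ℝ E}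
    (hg : ∀ x, 0 ≤ x → Tendsto (fun n => g n x) atTop (𝓝 0)) :
    Tendsto (fun n => StrongDual.toWeakDual (g n)) atTop (𝓝 0) := by
  rw [tendsto_iff_forall_eval_tendsto_topDualPairing]
  intro x
  have h := (hg _ (posPart_nonneg x)).sub (hg _ (negPart_nonneg x))
  simp only [← map_sub, posPart_sub_negPart, sub_zero] at h
  exact h

section Grothendieck

variable {E : Type u} [NormedAddCommGroup E] [NormedSpace ℝ E] [Lattice E] [IsOrderedAddMonoid E]
  [HasSolidNorm E] [CompleteSpace E]

/-- The map `P` restricts to the projection onto the band generated by `w` on the positive cone;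
there, composing a functional with `P` gives a functional. -/
theorem OrderContinuous.exists_band_projection (hE : OrderContinuous E) {w : E} (hw : 0 ≤ w) :
    ∃ P : E → E, (∀ x, Tendsto (fun m : ℕ => x ⊓ m • w) atTop (𝓝 (P x))) ∧
      ∀ f : StrongDual ℝ E, ∃ g : StrongDual ℝ E, ∀ x, 0 ≤ x → g x = f (P x) := by
  choose P hP using fun x : E => hE.exists_tendsto_of_monotone (s := fun m : ℕ => x ⊓ m • w)
    (fun m n hmn => inf_le_inf_left x (nsmul_le_nsmul_left hw hmn))
    ⟨x, by rintro _ ⟨m, rfl⟩; exact inf_le_left⟩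
  have hadd : ∀ x y, 0 ≤ x → 0 ≤ y → P (x + y) = P x + P y := by
    intro x y hx hy
    have hsum := (hP x).add (hP y)
    have hdouble : Tendsto (fun m : ℕ => 2 * m) atTop atTop :=
      tendsto_id.const_mul_atTop' two_pos
    refine le_antisymm (le_of_tendsto_of_tendsto' (hP (x + y)) hsum fun m => ?_)
      (le_of_tendsto_of_tendsto' hsum ((hP (x + y)).comp hdouble) fun m => ?_)
    · have hm : 0 ≤ m • w := nsmul_nonneg hw m
      rw [inf_add, add_inf, add_inf]
      exact le_inf (le_inf inf_le_left (inf_le_right.trans (le_add_of_nonneg_left hx)))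
        (le_inf (inf_le_right.trans (le_add_of_nonneg_right hy))
          (inf_le_right.trans (le_add_of_nonneg_left hm)))
    · refine le_inf (add_le_add inf_le_left inf_le_left) ?_
      change _ ≤ (2 * m) • w
      rw [two_mul, add_nsmul]
      exact add_le_add inf_le_right inf_le_right
  refine ⟨P, hP, fun f => exists_dual_eqOn_nonneg_of_additive (fun x => f (P x))
    (fun x y hx hy => by simp only [hadd x y hx hy, map_add]) ‖f‖ fun x hx => ?_⟩
  exact abs_dual_apply_le f (ge_of_tendsto' (hP x) fun m => le_inf hx (nsmul_nonneg hw m))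
    (le_of_tendsto' (hP x) fun m => inf_le_left)

variable [IsOrderedModule ℝ E]

/-- Truncation at `x` makes the sequence order bounded, and the upper limit of the truncations is
annihilated by all positive functionals. -/
theorem OrderContinuous.tendsto_inf_zero_of_summable (hE : OrderContinuous E) {d : ℕ → E}
    (hd : ∀ n, 0 ≤ d n) (hsum : ∀ f : StrongDual ℝ E, 0 ≤ f → Summable fun n => f (d n))
    {x : E} (hx : 0 ≤ x) : Tendsto (fun n => d n ⊓ x) atTop (𝓝 0) := by
  obtain ⟨h, l, hh, hl, hl0, hnull⟩ := hE.exists_limsup (x := x) (u := fun n => d n ⊓ x)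
    fun n => ⟨le_inf (hd n) hx, inf_le_right⟩
  have hl : Tendsto h atTop (𝓝 0) := by
    convert! hl
    refine le_antisymm hl0 (nonpos_of_forall_dual_nonneg fun f hf => (hnull f hf ?_).le)
    exact Summable.of_nonneg_of_le (fun n => dual_nonneg_iff.1 hf _ (le_inf (hd n) hx))
      (fun n => dual_mono hf inf_le_left) (hsum f hf)
  exact squeeze_zero_norm
    (fun n => norm_le_norm_of_nonneg_of_le (le_inf (hd n) hx) (hh n).1) (by simpa using hl.norm)

/-- In an order continuous Banach lattice with the positive Grothendieck property, the gaps of a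
norm bounded increasing sequence are not bounded away from `0`.

Otherwise the Hahn–Banach theorem, applied to `d n - j • w` for the gaps `d n` and a weak unit
`w` of the ideal that they generate, gives positive functionals of norm at most `1` that are large
on gaps but small at `w`. Their components in the band of `w` are weak-star null, while they stay
away from `0` on a weak-star cluster point of the sequence in the bidual. -/
theorem PositiveGrothendieckProperty.not_gaps (hP : PositiveGrothendieckProperty E)
    (hE : OrderContinuous E) {s : ℕ → E} (hs : Monotone s) (hs0 : 0 ≤ s 0) {M : ℝ}
    (hM : ∀ n, ‖s n‖ ≤ M) {ε : ℝ} (hε : 0 < ε) (hgap : ∀ n, ε ≤ ‖s (n + 1) - s n‖) : False := by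
  have hsn : ∀ n, 0 ≤ s n := fun n => hs0.trans (hs n.zero_le)
  let d : ℕ → E := fun n => s (n + 1) - s n
  have hd : ∀ n, 0 ≤ d n := fun n => sub_nonneg.2 (hs n.le_succ)
  have hds : ∀ n, d n ≤ s (n + 1) := fun n => sub_le_self _ (hsn n)
  have hdM : ∀ n, ‖d n‖ ≤ M := fun n => (norm_le_norm_of_nonneg_of_le (hd n) (hds n)).trans (hM _)
  have hsum : ∀ f : StrongDual ℝ E, 0 ≤ f → Summable fun n => f (d n) := by
    intro f hf
    refine summable_of_sum_range_le (c := ‖f‖ * M) (fun n => dual_nonneg_iff.1 hf _ (hd n))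
      fun n => ?_
    rw [← map_sum, Finset.sum_range_sub]
    calc f (s n - s 0) ≤ f (s n) := dual_mono hf (sub_le_self _ hs0)
      _ ≤ ‖f (s n)‖ := le_abs_self _
      _ ≤ ‖f‖ * M := (f.le_opNorm _).trans (mul_le_mul_of_nonneg_left (hM n) (norm_nonneg f))
  -- `w` is a weak unit of the ideal generated by the gaps.
  have hws : Summable fun n => (1 / 2 : ℝ) ^ n • d n := by
    refine Summable.of_norm_bounded (summable_geometric_two.mul_right M) fun n => ?_
    rw [norm_smul, Real.norm_of_nonneg (by positivity)]
    exact mul_le_mul_of_nonneg_left (hdM n) (by positivity)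
  have hwd0 : ∀ n, 0 ≤ (1 / 2 : ℝ) ^ n • d n := fun n => smul_nonneg (by positivity) (hd n)
  let w : E := ∑' n, (1 / 2 : ℝ) ^ n • d n
  have hw : 0 ≤ w := tsum_nonneg hwd0
  have hdw : ∀ n, d n ≤ 2 ^ n • w := fun n => by
    have h1 : (1 / 2 : ℝ) ^ n • d n ≤ w := hws.le_tsum n fun k _ => hwd0 k
    have h2 := nsmul_le_nsmul_right h1 (2 ^ n)
    rwa [← Nat.cast_smul_eq_nsmul ℝ, smul_smul, Nat.cast_pow, Nat.cast_ofNat, ← mul_pow,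
      mul_one_div_cancel two_ne_zero, one_pow, one_smul] at h2
  have hex : ∀ j : ℕ, ∃ n, ∃ f : StrongDual ℝ E, 0 ≤ f ∧ (∀ y, f y ≤ ‖y⁺‖) ∧
      ε / 2 + j * f w ≤ f (d n) := by
    intro j
    have h0 := (hE.tendsto_inf_zero_of_summable hd hsum (nsmul_nonneg hw j)).norm
    rw [norm_zero] at h0
    obtain ⟨n, hn⟩ := (h0.eventually (gt_mem_nhds (half_pos hε))).exists
    obtain ⟨f, hf, hfle, hfn⟩ := exists_dual_nonneg_apply_eq_norm_posPart (d n - j • w)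
    refine ⟨n, f, hf, hfle, ?_⟩
    have h1 : d n = (d n - j • w)⁺ + d n ⊓ j • w := by
      rw [inf_eq_sub_posPart_sub, add_sub_cancel]
    have h2 : ‖d n‖ ≤ ‖(d n - j • w)⁺‖ + ‖d n ⊓ j • w‖ := by
      conv_lhs => rw [h1]
      exact norm_add_le _ _
    rw [map_sub, map_nsmul, nsmul_eq_mul] at hfn
    have := hgap n
    change ε ≤ ‖d n‖ at this
    linarith
  choose n f hf hfle hfd using hex
  have hfw0 : ∀ j, 0 ≤ f j w := fun j => dual_nonneg_iff.1 (hf j) w hw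
  have hfle' : ∀ j y, f j y ≤ ‖y‖ := fun j y => (hfle j y).trans (norm_posPart_le y)
  have hfw : Tendsto (fun j => f j w) atTop (𝓝 0) := by
    rw [← tendsto_add_atTop_iff_nat 1]
    have hlim : Tendsto (fun j : ℕ => M / ((j : ℝ) + 1)) atTop (𝓝 0) := by
      simpa [div_eq_mul_inv] using
        (tendsto_one_div_add_atTop_nhds_zero_nat (𝕜 := ℝ)).const_mul M
    refine squeeze_zero (fun j => hfw0 _) (fun j => ?_) hlim
    rw [le_div_iff₀ (by positivity), mul_comm]
    have h1 := hfd (j + 1)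
    have h2 := (hfle' (j + 1) _).trans (hdM (n (j + 1)))
    push_cast at h1
    linarith
  obtain ⟨P, hPt, hPf⟩ := hE.exists_band_projection hw
  choose g hg using fun j => hPf (f j)
  have hP0 : ∀ x, 0 ≤ x → 0 ≤ P x := fun x hx =>
    ge_of_tendsto' (hPt x) fun m => le_inf hx (nsmul_nonneg hw m)
  have hg0 : ∀ j, 0 ≤ g j := fun j => dual_nonneg_iff.2 fun x hx => by
    rw [hg j x hx]
    exact dual_nonneg_iff.1 (hf j) _ (hP0 x hx)
  have hgnull : ∀ x, 0 ≤ x → Tendsto (fun j => g j x) atTop (𝓝 0) := by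
    intro x hx
    refine tendsto_order.2 ⟨fun r hr => Eventually.of_forall fun j =>
      hr.trans_le (dual_nonneg_iff.1 (hg0 j) x hx), fun δ hδ => ?_⟩
    have hm : Tendsto (fun m : ℕ => ‖P x - x ⊓ m • w‖) atTop (𝓝 0) := by
      simpa using ((tendsto_const_nhds (x := P x)).sub (hPt x)).norm
    obtain ⟨m, hm⟩ := (hm.eventually (gt_mem_nhds (half_pos hδ))).exists
    have hmw : Tendsto (fun j => (m : ℝ) * f j w) atTop (𝓝 0) := by
      simpa using hfw.const_mul (m : ℝ)
    filter_upwards [hmw.eventually (gt_mem_nhds (half_pos hδ))] with j hj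
    have h1 : f j (x ⊓ m • w) ≤ m * f j w := by
      have := dual_mono (hf j) (inf_le_right : x ⊓ m • w ≤ m • w)
      rwa [map_nsmul, nsmul_eq_mul] at this
    have h2 := hfle' j (P x - x ⊓ m • w)
    rw [map_sub] at h2
    rw [hg j x hx]
    linarith
  have hweak := hP g hg0 (tendsto_toWeakDual_zero_of_nonneg hgnull)
  obtain ⟨φ, hφ⟩ := exists_bidual_tendsto (x := s) (U := Ultrafilter.of atTop)
    (Eventually.of_forall hM)
  have hφg : Tendsto (fun j => φ (g j)) atTop (𝓝 0) := by
    have h := ((WeakBilin.eval_continuous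
      (topDualPairing ℝ (StrongDual ℝ E)).flip φ).tendsto 0).comp hweak
    change Tendsto (fun j => φ (g j)) atTop (𝓝 (φ 0)) at h
    rwa [map_zero] at h
  have hlow : ∀ j, ε / 2 ≤ φ (g j) := by
    intro j
    have hPd : P (d (n j)) = d (n j) := by
      refine tendsto_nhds_unique (hPt _) (tendsto_const_nhds.congr' ?_)
      filter_upwards [eventually_ge_atTop (2 ^ n j)] with m hm
      exact (inf_eq_left.2 ((hdw _).trans (nsmul_le_nsmul_left hw hm))).symm
    have hgd : ε / 2 ≤ g j (d (n j)) := by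
      rw [hg j _ (hd _), hPd]
      have := mul_nonneg j.cast_nonneg (hfw0 j)
      linarith [hfd j]
    refine hgd.trans (ge_of_tendsto (hφ (g j)) (Ultrafilter.of_le atTop ?_))
    filter_upwards [eventually_ge_atTop (n j + 1)] with k hk
    exact dual_mono (hg0 j) ((hds _).trans (hs hk))
  have := ge_of_tendsto' hφg hlow
  linarith

/-- An order continuous Banach lattice with the positive Grothendieck property is a KB-space. -/
theorem PositiveGrothendieckProperty.exists_isLUB_mem_closure
    (hP : PositiveGrothendieckProperty E) (hE : OrderContinuous E) {D : Set E} (hne : D.Nonempty)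
    (hdir : DirectedOn (· ≤ ·) D) (hD0 : ∀ d ∈ D, 0 ≤ d) {M : ℝ} (hM : ∀ d ∈ D, ‖d‖ ≤ M) :
    ∃ l, IsLUB D l ∧ l ∈ closure D := by
  refine BanachLattice.exists_isLUB_mem_closure hdir ?_
  by_contra! hcon
  obtain ⟨ε, hε, hcon⟩ := hcon
  choose next hnextD hle hgap using hcon
  let F : D → D := fun d => ⟨next d d.2, hnextD d d.2⟩
  let s : ℕ → D := fun n => F^[n] ⟨hne.some, hne.some_mem⟩
  have hs : ∀ n, s (n + 1) = F (s n) := fun n => Function.iterate_succ_apply' F n _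
  refine hP.not_gaps hE (s := fun n => (s n : E)) (monotone_nat_of_le_succ fun n => ?_)
    (hD0 _ (s 0).2) (fun n => hM _ (s n).2) hε fun n => ?_
  · rw [hs]
    exact hle _ _
  · rw [hs]
    exact (hgap _ _).le

end Grothendieck

/-! ### Reflexivity of order continuous Banach lattices -/

section Bidual

attribute [local instance] dualLattice

theorem inclusionInDoubleDual_nonneg {E : Type u} [NormedAddCommGroup E] [NormedSpace ℝ E]
    [Lattice E] [IsOrderedAddMonoid E] [HasSolidNorm E] {x : E} (hx : 0 ≤ x) :
    0 ≤ NormedSpace.inclusionInDoubleDual ℝ E x :=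
  dual_nonneg_iff.2 fun _ hf => dual_nonneg_iff.1 hf x hx

variable {E : Type u} [NormedAddCommGroup E] [NormedSpace ℝ E] [Lattice E] [IsOrderedAddMonoid E]
  [HasSolidNorm E]

/-- An element of the bidual that is disjoint from `E` vanishes: on `[0, f]` there is a largest
functional annihilated by `ψ`, and disjointness from `x` forces it to agree with `f` at `x`. -/
theorem eq_zero_of_forall_inf_inclusion_eq_zero (hE' : OrderContinuous (StrongDual ℝ E))
    {ψ : StrongDual ℝ (StrongDual ℝ E)} (hψ : 0 ≤ ψ)
    (hdisj : ∀ x : E, 0 ≤ x → ψ ⊓ NormedSpace.inclusionInDoubleDual ℝ E x = 0) : ψ = 0 := by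
  refine dual_ext_of_nonneg fun f hf => ?_
  obtain ⟨k, ⟨⟨hk0, hkf⟩, hψk⟩, hmax⟩ := hE'.exists_greatest_null hψ hf
  have hfk : f = k := by
    refine dual_ext_of_nonneg fun x hx => le_antisymm ?_ (hkf x hx)
    obtain ⟨u, hu, hψu, hxu⟩ := hE'.exists_null_of_inf_eq_zero hψ (inclusionInDoubleDual_nonneg hx)
      (hdisj x hx) hf
    rw [NormedSpace.dual_def, sub_apply, sub_eq_zero] at hxu
    rw [hxu]
    exact hmax ⟨hu, hψu⟩ x hx
  rw [hfk, hψk, zero_apply]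

variable [CompleteSpace E]

/-- If `h` is strictly positive on `[0, z]`, then order continuity makes every positive `g` the
limit of its truncations `g ⊓ n • h`, uniformly on `[0, z]`, and `ω` vanishes on these
truncations. -/
theorem eq_zero_of_le_smul_inclusion (hE : OrderContinuous E) {z : E} (hz : 0 ≤ z)
    {h : StrongDual ℝ E} (hh : 0 ≤ h) (hstrict : ∀ u ∈ Set.Icc 0 z, h u = 0 → u = 0)
    {ω : StrongDual ℝ (StrongDual ℝ E)} (hω : 0 ≤ ω)
    (hωz : ω ≤ NormedSpace.inclusionInDoubleDual ℝ E z) (hωh : ω h = 0) : ω = 0 := by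
  refine dual_ext_of_nonneg fun g hg => le_antisymm ?_ (dual_nonneg_iff.1 hω g hg)
  rw [zero_apply]
  by_contra! hpos
  -- `ω g` is bounded by `(g - 2 ^ n • h)⁺ z`, for which the Riesz–Kantorovich formula is used.
  have hex : ∀ n : ℕ, ∃ y ∈ Set.Icc 0 z, ω g / 2 < g y - 2 ^ n * h y := by
    intro n
    have h1 : ω g ≤ ω (g - (2 : ℝ) ^ n • h)⁺ := by
      have := dual_mono hω (le_posPart (g - (2 : ℝ) ^ n • h))
      rwa [map_sub, map_smul, hωh, smul_zero, sub_zero] at this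
    have h2 : ω (g - (2 : ℝ) ^ n • h)⁺ ≤ (g - (2 : ℝ) ^ n • h)⁺ z :=
      hωz _ (posPart_nonneg _)
    have hlub := isLUB_dualSup_apply (g - (2 : ℝ) ^ n • h) 0 hz
    obtain ⟨_, ⟨y, hy, rfl⟩, hlt, -⟩ := hlub.exists_between
      (show ω g / 2 < dualSup (g - (2 : ℝ) ^ n • h) 0 z from
        (half_lt_self hpos).trans_le (h1.trans h2))
    exact ⟨y, hy, by simpa using hlt⟩
  choose y hy hlt using hex
  have hhy : ∀ n, 0 ≤ h (y n) := fun n => dual_nonneg_iff.1 hh _ (hy n).1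
  have hgz : ∀ n, g (y n) ≤ g z := fun n => dual_mono hg (hy n).2
  have hsum : Summable fun n => h (y n) := by
    refine Summable.of_nonneg_of_le hhy (fun n => ?_) (summable_geometric_two.mul_right (g z))
    rw [one_div, inv_pow, ← div_eq_inv_mul, le_div_iff₀ (by positivity), mul_comm]
    linarith [hlt n, hgz n]
  obtain ⟨v, l, hv, hl, hl0, hnull⟩ := hE.exists_limsup hy
  have hl' : l = 0 := hstrict l ⟨hl0, le_of_tendsto' hl fun n => (hv n).2⟩ (hnull h hh hsum)
  have hgv : Tendsto (fun n => g (v n)) atTop (𝓝 0) := by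
    have := (g.continuous.tendsto l).comp hl
    rwa [hl', map_zero] at this
  have : ω g / 2 ≤ 0 := ge_of_tendsto' hgv fun n => by
    have h1 := dual_mono hg (hv n).1
    have h2 := mul_nonneg (pow_nonneg zero_le_two n) (hhy n)
    linarith [hlt n]
  linarith

variable [IsOrderedModule ℝ E]

/-- `E` is order dense in the ideal that it generates in the bidual.

For small `ε`, the positive and negative parts of `ψ - ε x` are separated by Nakano's theorem; the
component `z` of `x` carried by the resulting functional `h` satisfies `ε z ≤ ψ`. -/
theorem exists_pos_inclusion_le (hE : OrderContinuous E) (hE' : OrderContinuous (StrongDual ℝ E))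
    {x : E} (hx : 0 ≤ x) {ψ : StrongDual ℝ (StrongDual ℝ E)} (hψ : 0 ≤ ψ)
    (hψx : ψ ≤ NormedSpace.inclusionInDoubleDual ℝ E x) (hψ0 : ψ ≠ 0) :
    ∃ z : E, 0 ≤ z ∧ z ≠ 0 ∧ NormedSpace.inclusionInDoubleDual ℝ E z ≤ ψ := by
  have hf : ∃ f : StrongDual ℝ E, 0 ≤ f ∧ 0 < ψ f := by
    by_contra! hcon
    exact hψ0 (dual_ext_of_nonneg fun f hf => le_antisymm (hcon f hf) (hψ f hf))
  obtain ⟨f, hf, hψf⟩ := hf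
  have hfx : 0 < f x := hψf.trans_le (hψx f hf)
  obtain ⟨ε, hε, hεf⟩ : ∃ ε : ℝ, 0 < ε ∧ ε * f x < ψ f :=
    ⟨ψ f / (2 * f x), by positivity, by field_simp; linarith⟩
  let σ : StrongDual ℝ (StrongDual ℝ E) := ψ - NormedSpace.inclusionInDoubleDual ℝ E (ε • x)
  have hεx : 0 ≤ ε • x := smul_nonneg hε.le hx
  obtain ⟨h, ⟨hh0, hhf⟩, hneg, hpos⟩ := hE'.exists_null_of_inf_eq_zero (f := σ⁻) (g := σ⁺)
    (negPart_nonneg σ) (posPart_nonneg σ) (by rw [inf_comm, posPart_inf_negPart_eq_zero]) hf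
  have hσψ' : σ ≤ ψ := sub_le_self ψ (inclusionInDoubleDual_nonneg hεx)
  have hσψ : σ⁺ ≤ ψ := sup_le hσψ' hψ
  have hhx : 0 < h x := by
    have h1 : σ f ≤ σ⁺ f := le_posPart σ f hf
    have h2 : σ⁺ h ≤ h x := (hσψ.trans hψx) h hh0
    have h3 : σ f = ψ f - ε * f x := by
      change ψ f - f (ε • x) = _
      rw [map_smul, smul_eq_mul]
    rw [map_sub, sub_eq_zero] at hpos
    linarith
  obtain ⟨u, ⟨⟨hu0, hux⟩, hhu⟩, hmax⟩ := hE.exists_greatest_null hh0 hx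
  have hz : 0 ≤ x - u := sub_nonneg.2 hux
  have hstrict : ∀ v ∈ Set.Icc 0 (x - u), h v = 0 → v = 0 := by
    intro v hv hhv
    have hvu : v + u ≤ u := hmax
      ⟨⟨add_nonneg hv.1 hu0, le_sub_iff_add_le.1 hv.2⟩, by rw [map_add, hhv, hhu, add_zero]⟩
    exact le_antisymm (by simpa using hvu) hv.1
  have hεz : 0 ≤ ε • (x - u) := smul_nonneg hε.le hz
  refine ⟨ε • (x - u), hεz, fun h0 => ?_, ?_⟩
  · have := congrArg h h0
    rw [map_smul, map_sub, hhu, sub_zero, map_zero, smul_eq_mul] at this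
    exact (mul_pos hε hhx).ne' this
  · let χ : StrongDual ℝ (StrongDual ℝ E) :=
      NormedSpace.inclusionInDoubleDual ℝ E (ε • (x - u)) - ψ
    let ω : StrongDual ℝ (StrongDual ℝ E) := χ⁺
    have hωle : χ ≤ ω := le_posPart χ
    suffices hωeq : ω = 0 by
      rw [hωeq] at hωle
      exact sub_nonpos.1 hωle
    have hω0 : 0 ≤ ω := posPart_nonneg χ
    have hχz : χ ≤ NormedSpace.inclusionInDoubleDual ℝ E (ε • (x - u)) :=
      sub_le_self (NormedSpace.inclusionInDoubleDual ℝ E (ε • (x - u))) hψ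
    have hωz : ω ≤ NormedSpace.inclusionInDoubleDual ℝ E (ε • (x - u)) :=
      sup_le hχz (inclusionInDoubleDual_nonneg hεz)
    have hχσ : χ ≤ -σ := fun g hg => by
      have h1 : g (ε • (x - u)) ≤ g (ε • x) :=
        dual_mono hg (smul_le_smul_of_nonneg_left (sub_le_self x hu0) hε.le)
      change g (ε • (x - u)) - ψ g ≤ -(ψ g - g (ε • x))
      linarith
    have hωσ : ω ≤ σ⁻ := sup_le (hχσ.trans (neg_le_negPart σ)) (negPart_nonneg σ)
    have hωh : ω h = 0 := le_antisymm ((hωσ h hh0).trans_eq hneg) (hω0 h hh0)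
    refine eq_zero_of_le_smul_inclusion hE hεz hh0 (fun v hv hhv => ?_) hω0 hωz hωh
    have hv' : ε⁻¹ • v = 0 := hstrict _ ⟨smul_nonneg (inv_nonneg.2 hε.le) hv.1, by
      have := smul_le_smul_of_nonneg_left hv.2 (inv_nonneg.2 hε.le)
      rwa [inv_smul_smul₀ hε.ne'] at this⟩ (by rw [map_smul, hhv, smul_zero])
    exact (smul_eq_zero.1 hv').resolve_left (inv_ne_zero hε.ne')

/-- A maximal element of `E₊` below `φ` differs from `φ` by an element disjoint from `E`. -/
theorem mem_range_inclusion_of_nonneg (hP : PositiveGrothendieckProperty E)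
    (hE : OrderContinuous E) (hE' : OrderContinuous (StrongDual ℝ E))
    {φ : StrongDual ℝ (StrongDual ℝ E)} (hφ : 0 ≤ φ) :
    φ ∈ Set.range (NormedSpace.inclusionInDoubleDual ℝ E) := by
  let J := NormedSpace.inclusionInDoubleDual ℝ E
  let A : Set E := {x | 0 ≤ x ∧ J x ≤ φ}
  have hA : IsClosed A := by
    have hAeq : A = Set.Ici 0 ∩ ⋂ f ∈ Set.Ici (0 : StrongDual ℝ E), {x | f x ≤ φ f} := by
      ext x
      simp only [Set.mem_inter_iff, Set.mem_iInter]
      exact Iff.rfl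
    rw [hAeq]
    exact isClosed_Ici.inter (isClosed_biInter fun f _ => isClosed_le f.continuous continuous_const)
  have hnorm : ∀ x ∈ A, ‖x‖ ≤ ‖φ‖ := fun x hx => by
    rw [← (NormedSpace.inclusionInDoubleDualLi ℝ (E := E)).norm_map x]
    exact norm_le_norm_of_nonneg_of_le (E := StrongDual ℝ (StrongDual ℝ E))
      (inclusionInDoubleDual_nonneg hx.1) hx.2
  obtain ⟨x, -, hx⟩ := zorn_le_nonempty₀ A (fun c hcA hc y hy => by
    obtain ⟨l, hl, hcl⟩ := hP.exists_isLUB_mem_closure hE ⟨y, hy⟩ hc.directedOn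
      (fun d hd => (hcA hd).1) (fun d hd => hnorm d (hcA hd))
    exact ⟨l, hA.closure_subset_iff.2 hcA hcl, hl.1⟩) 0 ⟨le_rfl, by simpa using hφ⟩
  have hx0 : 0 ≤ φ - J x := sub_nonneg.2 hx.prop.2
  refine ⟨x, (sub_eq_zero.1 ?_).symm⟩
  refine eq_zero_of_forall_inf_inclusion_eq_zero hE' hx0 fun y hy => ?_
  by_contra hne
  obtain ⟨z, hz, hz0, hzle⟩ := exists_pos_inclusion_le hE hE' hy
    (le_inf hx0 (inclusionInDoubleDual_nonneg hy)) inf_le_right hne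
  have hxz : x + z ∈ A := ⟨add_nonneg hx.prop.1 hz, by
    rw [map_add]
    exact le_sub_iff_add_le'.1 (hzle.trans inf_le_left)⟩
  have := hx.le_of_ge hxz (le_add_of_nonneg_right hz)
  exact hz0 (le_antisymm (by simpa using this) hz)

theorem reflexive_of_orderContinuous (hP : PositiveGrothendieckProperty E)
    (hE : OrderContinuous E) (hE' : OrderContinuous (StrongDual ℝ E)) : Reflexive E := by
  intro φ
  obtain ⟨x, hx⟩ := mem_range_inclusion_of_nonneg hP hE hE' (posPart_nonneg φ)
  obtain ⟨y, hy⟩ := mem_range_inclusion_of_nonneg hP hE hE' (negPart_nonneg φ)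
  exact ⟨x - y, by rw [map_sub, hx, hy, posPart_sub_negPart]⟩

end Bidual

end BanachLattice

theorem mainTheorem4 (E : Type u) [NormedAddCommGroup E] [NormedSpace ℝ E] [CompleteSpace E]
    [Lattice E] [IsOrderedAddMonoid E] [IsOrderedModule ℝ E] [HasSolidNorm E]
    (hE : BanachLattice.SigmaOrderComplete E)
    (hE' : BanachLattice.OrderContinuous (StrongDual ℝ E))
    (hPGP : BanachLattice.PositiveGrothendieckProperty E) :
    BanachLattice.Reflexive E ↔ BanachLattice.OrderContinuous E :=
  ⟨BanachLattice.orderContinuous_of_reflexive,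
    fun h => BanachLattice.reflexive_of_orderContinuous hPGP h hE'⟩
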